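/- Let $\zeta$ be the Riemann zeta function and let $B_j$ be the Bernoulli numbers, $\frac{x}{e^x-1}=\sum_{j\ge 0}B_j\frac{x^j}{j!}$. For every integer $n\ge 1$ the two series below converge and $$\zeta(4n+1)+2\sum_{k=1}^\infty\frac{1}{k^{4n+1}\,(e^{2\pi k}-1)}+\frac{\pi}{2n}\sum_{k=1}^\infty\frac{1}{k^{4n}\sinh^2(\pi k)}=\frac{2^{4n}}{2n}\,\pi^{4n+1}\sum_{q=1}^{2n+1}\frac{(-1)^{q+1}B_{2q}\,B_{4n+2-2q}}{(2q-1)!\,(4n+2-2q)!}.$$ In particular, for $n=1$, $$\zeta(5)+2\sum_{k=1}^\infty\frac{1}{k^5\,(e^{2\pi k}-1)}+\frac{\pi}{2}\sum_{k=1}^\infty\frac{1}{k^4\sinh^2(\pi k)}=\frac{13}{3780}\,\pi^5.$$ -/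

import Mathlib

/-! Evaluate in two ways the absolutely convergent double sum over k, m ≥ 1 of k^(-4n) (2/(k²+m²) +
(1/n)(k²-m²)/(k²+m²)²).

Summing over m at fixed k, the partial fractions of coth and 1/sinh² at x = k produce the terms of
the three series, times π, minus (1 + 1/(2n)) k^(-4n-2).

Averaging the summand with its swap k ↔ m gives a finite combination of products k^(-2q)
m^(-2(2n+1-q)) (`symmetrized_kernel_eq_sum`), so the same sum is a combination of products of even
zeta values. Euler's formula turns these into Bernoulli numbers, and the leftover ζ(4n+2) supplies
the term q = 2n+1. -/

/-! ### Partial fractions of coth and 1/sinh² -/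

/-- Euler's cotangent expansion at ix, multiplied by i to become real. -/
theorem hasSum_coth_partialFractions {x : ℝ} (hx : 0 < x) :
    HasSum (fun m : ℕ+ => 2 * x / (x ^ 2 + ((m : ℕ) : ℝ) ^ 2))
      (Real.pi * (1 + 2 / (Real.exp (2 * Real.pi * x) - 1)) - 1 / x) := by
  have hI : (Complex.I * x) ∈ Complex.integerComplement := by
    rw [Complex.mem_integerComplement_iff]
    rintro ⟨n, hn⟩
    have := congrArg Complex.im hn
    simp at this
    exact hx.ne this
  have hx' : (x : ℂ) ≠ 0 := by exact_mod_cast hx.ne'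
  have hterm : ∀ m : ℕ, cotTerm (Complex.I * x) m
      = -Complex.I * ((2 * x / (x ^ 2 + ((m + 1 : ℕ) : ℝ) ^ 2) : ℝ) : ℂ) := by
    intro m
    have h : (x : ℂ) ^ 2 + ((m : ℂ) + 1) ^ 2 ≠ 0 := by
      have : (0 : ℝ) < x ^ 2 + ((m : ℝ) + 1) ^ 2 := by positivity
      exact_mod_cast this.ne'
    have h' : (Complex.I * x + (m + 1)) * (Complex.I * x - (m + 1))
        = -((x : ℂ) ^ 2 + ((m : ℂ) + 1) ^ 2) := by
      linear_combination (x : ℂ) ^ 2 * Complex.I_sq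
    rw [cotTerm_identity hI, h']
    push_cast
    field_simp
  have hs := (summable_cotTerm hI).hasSum_iff_tendsto_nat.mpr (tendsto_logDeriv_euler_cot_sub hI)
  simp_rw [hterm] at hs
  have hs2 := hs.mul_left Complex.I
  have hI2 : ∀ w : ℂ, Complex.I * (-Complex.I * w) = w := fun w => by
    linear_combination -w * Complex.I_sq
  simp only [hI2] at hs2
  have hexp : (0 : ℝ) < Real.exp (2 * Real.pi * x) - 1 := by
    have : 0 < 2 * Real.pi * x := by positivity
    linarith [Real.add_one_lt_exp this.ne']
  have hval : Complex.I * (Real.pi * Complex.cot (Real.pi * (Complex.I * x))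
      - 1 / (Complex.I * x)) =
      ((Real.pi * (1 + 2 / (Real.exp (2 * Real.pi * x) - 1)) - 1 / x : ℝ) : ℂ) := by
    have hE : Complex.exp (2 * Complex.I * (Real.pi * (Complex.I * x)))
        = ((Real.exp (2 * Real.pi * x) : ℝ) : ℂ)⁻¹ := by
      rw [Complex.ofReal_exp, ← Complex.exp_neg]
      congr 1
      push_cast
      linear_combination 2 * Real.pi * x * Complex.I_sq
    have hE0 : ((Real.exp (2 * Real.pi * x) : ℝ) : ℂ) ≠ 0 := by
      exact_mod_cast (Real.exp_pos _).ne'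
    have hE1 : ((Real.exp (2 * Real.pi * x) : ℝ) : ℂ) - 1 ≠ 0 := by
      exact_mod_cast hexp.ne'
    rw [Complex.cot_eq_exp_ratio, hE]
    push_cast [-Complex.ofReal_exp]
    generalize ((Real.exp (2 * Real.pi * x) : ℝ) : ℂ) = E at *
    have hE2 : 1 - E⁻¹ ≠ 0 := by
      intro h
      apply hE1
      rw [sub_eq_zero, eq_comm, inv_eq_one] at h
      rw [h, sub_self]
    have : E⁻¹ + 1 = (1 + 2 / (E - 1)) * (1 - E⁻¹) := by
      field_simp
      ring
    rw [this]
    field_simp [Complex.I_ne_zero]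
  rw [hval, Complex.hasSum_ofReal] at hs2
  exact (hasSum_pnat_iff_hasSum_succ (f := fun m : ℕ => 2 * x / (x ^ 2 + (m : ℝ) ^ 2))).mpr hs2

/-- Lipschitz's formula for ∑ 1/(z+n)² at z = ix, where q = exp(-2πx), with the terms n = ±m paired.
-/
theorem hasSum_inv_sinh_sq_partialFractions {x : ℝ} (hx : 0 < x) :
    HasSum (fun m : ℕ+ =>
        2 * (x ^ 2 - ((m : ℕ) : ℝ) ^ 2) / (x ^ 2 + ((m : ℕ) : ℝ) ^ 2) ^ 2)
      (Real.pi ^ 2 / Real.sinh (Real.pi * x) ^ 2 - 1 / x ^ 2) := by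
  set z : UpperHalfPlane := ⟨Complex.I * x, by simpa using hx⟩ with hz
  have hzc : (z : ℂ) = Complex.I * x := rfl
  have key := EisensteinSeries.qExpansion_identity (k := 1) le_rfl z
  have hsum : Summable fun n : ℤ => 1 / ((z : ℂ) + n) ^ 2 := by
    have := EisensteinSeries.linear_right_summable (z : ℂ) 1 (k := 2) (by norm_num)
    simpa using this
  have hx0 : (x : ℂ) ≠ 0 := by exact_mod_cast hx.ne'
  set E : ℝ := Real.exp (Real.pi * x) with hEdef
  have hE1 : 1 < E := Real.one_lt_exp_iff.mpr (by positivity)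
  have hq : Complex.exp (2 * Real.pi * Complex.I * z) = (((E ^ 2)⁻¹ : ℝ) : ℂ) := by
    rw [hEdef, ← Real.exp_nat_mul, ← Real.exp_neg, Complex.ofReal_exp, hzc]
    congr 1
    push_cast
    linear_combination 2 * Real.pi * x * Complex.I_sq
  have hqn : ‖(((E ^ 2)⁻¹ : ℝ) : ℂ)‖ < 1 := by
    rw [Complex.norm_real, Real.norm_of_nonneg (by positivity)]
    exact inv_lt_one_of_one_lt₀ (by nlinarith)
  rw [hq] at key
  simp only [pow_one, Nat.factorial_one, Nat.cast_one, div_one] at key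
  rw [tsum_coe_mul_geometric_of_norm_lt_one hqn] at key
  have hs := hsum.hasSum
  norm_num only at key hs
  rw [key] at hs
  have hpos : ∀ m : ℕ, (0 : ℝ) < x ^ 2 + (m : ℝ) ^ 2 := fun m => by positivity
  have hterm : ∀ m : ℕ, 1 / ((z : ℂ) + ((m : ℤ) : ℂ)) ^ 2 + 1 / ((z : ℂ) + ((-(m : ℤ) : ℤ) : ℂ)) ^ 2
      = ((-(2 * (x ^ 2 - (m : ℝ) ^ 2) / (x ^ 2 + (m : ℝ) ^ 2) ^ 2) : ℝ) : ℂ) := by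
    intro m
    have hp : (x : ℂ) ^ 2 + (m : ℂ) ^ 2 ≠ 0 := by exact_mod_cast (hpos m).ne'
    have hprod : ((z : ℂ) + m) * (z - m) = -((x : ℂ) ^ 2 + (m : ℂ) ^ 2) := by
      rw [hzc]
      linear_combination (x : ℂ) ^ 2 * Complex.I_sq
    have h12 : ((z : ℂ) + m) * (z - m) ≠ 0 := by rw [hprod]; exact neg_ne_zero.mpr hp
    have h1 := left_ne_zero_of_mul h12
    have h2 := right_ne_zero_of_mul h12
    have h3 : 1 / ((z : ℂ) + m) ^ 2 + 1 / (z - m) ^ 2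
        = (2 * (z ^ 2 + m ^ 2)) / (((z : ℂ) + m) * (z - m)) ^ 2 := by
      field_simp
      ring
    push_cast
    rw [← sub_eq_add_neg, h3, hprod, hzc, mul_pow, Complex.I_sq, neg_sq, ← neg_div]
    ring
  have hs2 := hs.nat_add_neg
  simp only [hterm] at hs2
  -- Pairing n with -n over m ≥ 0 counts n = 0 twice, hence the extra 1/z².
  have hval : (-2 * (Real.pi : ℂ) * Complex.I) ^ 2 *
        ((((E ^ 2)⁻¹ : ℝ) : ℂ) / (1 - (((E ^ 2)⁻¹ : ℝ) : ℂ)) ^ 2) + 1 / ((z : ℂ) + ((0 : ℤ) : ℂ)) ^ 2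
      = ((-(Real.pi ^ 2 / Real.sinh (Real.pi * x) ^ 2 + 1 / x ^ 2) : ℝ) : ℂ) := by
    have hsinh : Real.pi ^ 2 / Real.sinh (Real.pi * x) ^ 2
        = 4 * Real.pi ^ 2 * ((E ^ 2)⁻¹ / (1 - (E ^ 2)⁻¹) ^ 2) := by
      rw [Real.sinh_eq, Real.exp_neg, ← hEdef]
      have h1 : E ^ 2 - 1 ≠ 0 := by nlinarith
      have h2 : (E - E⁻¹) / 2 = E * (1 - (E ^ 2)⁻¹) / 2 := by field_simp
      have h3 : 1 - (E ^ 2)⁻¹ ≠ 0 := by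
        have : 1 - (E ^ 2)⁻¹ = (E ^ 2 - 1) / E ^ 2 := by field_simp
        rw [this]
        positivity
      rw [h2]
      field_simp
      norm_num
    rw [hsinh, hzc]
    push_cast
    rw [add_zero, mul_pow, mul_pow, mul_pow, Complex.I_sq]
    ring
  rw [hval, Complex.hasSum_ofReal] at hs2
  refine (hasSum_pnat_iff
    (f := fun m : ℕ => 2 * (x ^ 2 - (m : ℝ) ^ 2) / (x ^ 2 + (m : ℝ) ^ 2) ^ 2)).mpr ?_
  convert hs2.neg using 1
  · simp
  · push_cast
    field_simp
    ring

/-! ### Symmetrization of the kernel -/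

theorem sq_add_mul_alternating_sum (x y : ℝ) (M : ℕ) :
    (x + y) ^ 2 * ∑ q ∈ Finset.Icc 1 M, (-1) ^ q * (q : ℝ) * (x ^ q * y ^ (M + 1 - q)) =
      x * y * ((-1) ^ M * (M * x ^ (M + 1) + (M + 1) * x ^ M * y) - y ^ (M + 1)) := by
  induction M with
  | zero => simp
  | succ M ih =>
    rw [Finset.sum_Icc_succ_top (by omega)]
    have h : ∑ q ∈ Finset.Icc 1 M, (-1) ^ q * (q : ℝ) * (x ^ q * y ^ (M + 1 + 1 - q))
        = y * ∑ q ∈ Finset.Icc 1 M, (-1) ^ q * (q : ℝ) * (x ^ q * y ^ (M + 1 - q)) := by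
      rw [Finset.mul_sum]
      refine Finset.sum_congr rfl fun q hq => ?_
      rw [Finset.mem_Icc] at hq
      rw [show M + 1 + 1 - q = (M + 1 - q) + 1 by omega, pow_succ]
      ring
    rw [h, mul_add, mul_left_comm, ih, show M + 1 + 1 - (M + 1) = 1 by omega]
    push_cast
    ring

/-- With x = 1/a and y = 1/b, the part 2xy(x^(2n)+y^(2n))/(x+y) alone has a pole at x = -y. The
weight 1/n is the one for which the second part cancels it, leaving a polynomial in x, y. -/
theorem symmetrized_kernel_eq_sum {n : ℕ} (hn : n ≠ 0) {a b : ℝ} (ha : 0 < a) (hb : 0 < b) :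
    1 / a ^ (2 * n) * (2 / (a + b) + 1 / n * ((a - b) / (a + b) ^ 2)) +
      1 / b ^ (2 * n) * (2 / (b + a) + 1 / n * ((b - a) / (b + a) ^ 2)) =
    1 / n * (∑ q ∈ Finset.Icc 1 (2 * n),
        (-1) ^ q * (q : ℝ) * (1 / a ^ q * (1 / b ^ (2 * n + 1 - q))) +
      ∑ q ∈ Finset.Icc 1 (2 * n),
        (-1) ^ q * (q : ℝ) * (1 / b ^ q * (1 / a ^ (2 * n + 1 - q)))) := by
  have h1 := sq_add_mul_alternating_sum (1 / a) (1 / b) (2 * n)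
  have h2 := sq_add_mul_alternating_sum (1 / b) (1 / a) (2 * n)
  simp only [one_div_pow, (even_two_mul n).neg_one_pow] at h1 h2
  set P := ∑ q ∈ Finset.Icc 1 (2 * n),
        (-1) ^ q * (q : ℝ) * (1 / a ^ q * (1 / b ^ (2 * n + 1 - q)))
  set Q := ∑ q ∈ Finset.Icc 1 (2 * n),
        (-1) ^ q * (q : ℝ) * (1 / b ^ q * (1 / a ^ (2 * n + 1 - q)))
  have hn' : (n : ℝ) ≠ 0 := by exact_mod_cast hn
  have hab : 1 / a + 1 / b ≠ 0 := by positivity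
  refine mul_left_cancel₀ (pow_ne_zero 2 hab) ?_
  rw [mul_left_comm _ (1 / (n : ℝ)), mul_add _ P, h1, add_comm (1 / a), h2]
  push_cast
  simp only [pow_succ a (2 * n), pow_succ b (2 * n)]
  field_simp
  ring

/-! ### The double sum, convergence and Bernoulli numbers -/

theorem hasSum_pnat_one_div_pow_even {q : ℕ} (hq : q ≠ 0) :
    HasSum (fun k : ℕ+ => 1 / (((k : ℕ) : ℝ) ^ 2) ^ q)
      ((-1 : ℝ) ^ (q + 1) * (2 : ℝ) ^ (2 * q - 1) * Real.pi ^ (2 * q) *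
        bernoulli (2 * q) / (Nat.factorial (2 * q))) := by
  refine (hasSum_pnat_iff (f := fun k : ℕ => 1 / ((k : ℝ) ^ 2) ^ q)).mpr ?_
  simpa [pow_mul, hq] using hasSum_zeta_nat hq

theorem hasSum_symmetrized_kernel {n : ℕ} (hn : n ≠ 0) (Z : ℕ → ℝ)
    (hZ : ∀ q, q ≠ 0 → HasSum (fun k : ℕ+ => 1 / (((k : ℕ) : ℝ) ^ 2) ^ q) (Z q)) :
    HasSum (fun p : ℕ+ × ℕ+ => 1 / (((p.1 : ℕ) : ℝ) ^ 2) ^ (2 * n) *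
        (2 / (((p.1 : ℕ) : ℝ) ^ 2 + ((p.2 : ℕ) : ℝ) ^ 2) +
          1 / n * ((((p.1 : ℕ) : ℝ) ^ 2 - ((p.2 : ℕ) : ℝ) ^ 2) /
            (((p.1 : ℕ) : ℝ) ^ 2 + ((p.2 : ℕ) : ℝ) ^ 2) ^ 2)))
      (1 / n * ∑ q ∈ Finset.Icc 1 (2 * n), (-1) ^ q * (q : ℝ) * (Z q * Z (2 * n + 1 - q))) := by
  set T : ℕ+ × ℕ+ → ℝ := fun p => 1 / (((p.1 : ℕ) : ℝ) ^ 2) ^ (2 * n) *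
        (2 / (((p.1 : ℕ) : ℝ) ^ 2 + ((p.2 : ℕ) : ℝ) ^ 2) +
          1 / n * ((((p.1 : ℕ) : ℝ) ^ 2 - ((p.2 : ℕ) : ℝ) ^ 2) /
            (((p.1 : ℕ) : ℝ) ^ 2 + ((p.2 : ℕ) : ℝ) ^ 2) ^ 2)) with hT
  have hprod : ∀ {q r : ℕ}, q ≠ 0 → r ≠ 0 → HasSum (fun p : ℕ+ × ℕ+ =>
      1 / (((p.1 : ℕ) : ℝ) ^ 2) ^ q * (1 / (((p.2 : ℕ) : ℝ) ^ 2) ^ r)) (Z q * Z r) :=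
    fun {q r} hq hr => (hZ q hq).mul (hZ r hr)
      ((hZ q hq).summable.mul_of_nonneg (hZ r hr).summable (fun _ => by positivity)
        (fun _ => by positivity))
  have hn1 : (1 : ℝ) ≤ n := by exact_mod_cast Nat.one_le_iff_ne_zero.mpr hn
  have hsum : Summable T := by
    -- The kernel is at most (2 + 1/n)/(a+b) ≤ 3/b times a^(-2n), where a = k² and b = m².
    refine Summable.of_norm_bounded
      (((hprod (q := 2 * n) (r := 1) (by omega) one_ne_zero).summable).mul_left 3) ?_
    rintro ⟨k, m⟩
    have hk : (0 : ℝ) < ((k : ℕ) : ℝ) ^ 2 := by positivity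
    have hm : (0 : ℝ) < ((m : ℕ) : ℝ) ^ 2 := by positivity
    simp only [hT, pow_one]
    generalize ((k : ℕ) : ℝ) ^ 2 = a at hk
    generalize ((m : ℕ) : ℝ) ^ 2 = b at hm
    have h1 : 1 / (a + b) ≤ 1 / b := one_div_le_one_div_of_le hm (by linarith)
    have h2 : |(a - b) / (a + b) ^ 2| ≤ 1 / (a + b) := by
      rw [abs_div, abs_of_pos (by positivity : 0 < (a + b) ^ 2),
        div_le_div_iff₀ (by positivity) (by positivity)]
      have : |a - b| ≤ a + b := abs_le.mpr ⟨by linarith, by linarith⟩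
      nlinarith
    have h3 : |1 / (n : ℝ) * ((a - b) / (a + b) ^ 2)| ≤ 1 / (a + b) := by
      rw [abs_mul, abs_of_nonneg (by positivity)]
      exact (mul_le_of_le_one_left (abs_nonneg _) (by rw [div_le_one] <;> linarith)).trans h2
    rw [Real.norm_eq_abs, abs_mul, abs_of_nonneg (by positivity : 0 ≤ 1 / a ^ (2 * n)),
      mul_left_comm]
    refine mul_le_mul_of_nonneg_left ?_ (by positivity)
    refine (abs_add_le _ _).trans ?_
    rw [abs_of_nonneg (by positivity : 0 ≤ 2 / (a + b)), show 2 / (a + b) = 2 * (1 / (a + b)) by ring]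
    linarith
  have hP : HasSum (fun p : ℕ+ × ℕ+ => ∑ q ∈ Finset.Icc 1 (2 * n), (-1) ^ q * (q : ℝ) *
      (1 / (((p.1 : ℕ) : ℝ) ^ 2) ^ q * (1 / (((p.2 : ℕ) : ℝ) ^ 2) ^ (2 * n + 1 - q))))
      (∑ q ∈ Finset.Icc 1 (2 * n), (-1) ^ q * (q : ℝ) * (Z q * Z (2 * n + 1 - q))) := by
    refine hasSum_sum fun q hq => ?_
    rw [Finset.mem_Icc] at hq
    exact (hprod (by omega) (by omega)).mul_left _
  have hP' := (Equiv.prodComm ℕ+ ℕ+).hasSum_iff.mpr hP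
  have hT' := (Equiv.prodComm ℕ+ ℕ+).hasSum_iff.mpr hsum.hasSum
  have hsym := (hP.add hP').mul_left (1 / (n : ℝ))
  -- The swap preserves the total, so this computes twice the sum; the two sums over q likewise have
  -- equal totals.
  have heq := (hsum.hasSum.add hT').unique (by
    refine Eq.mpr (congrArg (fun f => HasSum f _) (funext fun p => ?_)) hsym
    have h1 : (0 : ℝ) < ((p.1 : ℕ) : ℝ) ^ 2 := by positivity
    have h2 : (0 : ℝ) < ((p.2 : ℕ) : ℝ) ^ 2 := by positivity
    exact symmetrized_kernel_eq_sum hn h1 h2)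
  convert hsum.hasSum using 1
  linarith

theorem summable_one_div_pow_mul_exp_sub_one (n : ℕ) :
    Summable (fun k : ℕ+ =>
      1 / (((k : ℕ) : ℝ) ^ (n + 2) * (Real.exp (2 * Real.pi * ((k : ℕ) : ℝ)) - 1))) := by
  refine Summable.of_nonneg_of_le (fun k => ?_) (fun k => ?_)
    (hasSum_pnat_one_div_pow_even one_ne_zero).summable
  all_goals
    have hk : (1 : ℝ) ≤ ((k : ℕ) : ℝ) := by exact_mod_cast k.2
    have hexp : 1 ≤ Real.exp (2 * Real.pi * ((k : ℕ) : ℝ)) - 1 := by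
      have := Real.add_one_le_exp (2 * Real.pi * ((k : ℕ) : ℝ))
      nlinarith [Real.pi_gt_three]
  · exact one_div_nonneg.mpr (mul_nonneg (by positivity) (by linarith))
  · rw [pow_one]
    refine one_div_le_one_div_of_le (by positivity) ?_
    exact (pow_le_pow_right₀ hk (by omega)).trans (le_mul_of_one_le_right (by positivity) hexp)

theorem summable_one_div_pow_mul_sinh_sq (n : ℕ) :
    Summable (fun k : ℕ+ =>
      1 / (((k : ℕ) : ℝ) ^ n * Real.sinh (Real.pi * ((k : ℕ) : ℝ)) ^ 2)) := by
  refine Summable.of_nonneg_of_le (fun k => by positivity) (fun k => ?_)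
    (hasSum_pnat_one_div_pow_even one_ne_zero).summable
  have hk : (1 : ℝ) ≤ ((k : ℕ) : ℝ) := by exact_mod_cast k.2
  have hsinh : ((k : ℕ) : ℝ) ≤ Real.sinh (Real.pi * ((k : ℕ) : ℝ)) := by
    refine le_trans ?_ (Real.self_le_sinh_iff.mpr (by positivity))
    nlinarith [Real.pi_gt_three]
  rw [pow_one]
  refine one_div_le_one_div_of_le (by positivity) ?_
  exact (pow_le_pow_left₀ (by linarith) hsinh 2).trans
    (le_mul_of_one_le_left (by positivity) (one_le_pow₀ hk))

/-- The weight q reduces (2q)! to (2q-1)!. The separate Z (2n+1) term is the summand q = 2n+1, where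
B₀ = 1. -/
theorem alternating_zeta_products_eq_bernoulli_sum {n : ℕ} (hn : n ≠ 0) (Z : ℕ → ℝ)
    (hZ : ∀ q, Z q = (-1 : ℝ) ^ (q + 1) * (2 : ℝ) ^ (2 * q - 1) * Real.pi ^ (2 * q) *
        bernoulli (2 * q) / (Nat.factorial (2 * q))) :
    1 / n * ∑ q ∈ Finset.Icc 1 (2 * n), (-1) ^ q * (q : ℝ) * (Z q * Z (2 * n + 1 - q)) +
        (1 + 1 / (2 * n)) * Z (2 * n + 1) =
      Real.pi ^ (4 * n + 2) * ((2 : ℝ) ^ (4 * n) / (2 * (n : ℝ)) *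
        ∑ q ∈ Finset.Icc 1 (2 * n + 1),
          (-1 : ℝ) ^ (q + 1) * bernoulli (2 * q) * bernoulli (4 * n + 2 - 2 * q) /
            ((Nat.factorial (2 * q - 1) : ℝ) * (Nat.factorial (4 * n + 2 - 2 * q) : ℝ))) := by
  have hn' : (n : ℝ) ≠ 0 := by exact_mod_cast hn
  rw [Finset.sum_Icc_succ_top (by omega), mul_add, mul_add]
  congr 1
  · rw [Finset.mul_sum, Finset.mul_sum, Finset.mul_sum]
    refine Finset.sum_congr rfl fun q hq => ?_
    rw [Finset.mem_Icc] at hq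
    obtain ⟨r, hr⟩ : ∃ r, q = r + 1 := ⟨q - 1, by omega⟩
    obtain ⟨s, hs⟩ : ∃ s, 2 * n = q + s := ⟨2 * n - q, by omega⟩
    have e1 : 2 * n + 1 - q = s + 1 := by omega
    have e2 : 4 * n + 2 - 2 * q = 2 * s + 2 := by omega
    have e3 : 2 * (s + 1) = 2 * s + 2 := by ring
    have e4 : 2 * (r + 1) = 2 * r + 1 + 1 := by ring
    have e5 : 4 * n = 2 * r + 2 * s + 2 := by omega
    rw [e1, e2, hZ, hZ, hr, e3, e4, e5, Nat.factorial_succ (2 * r + 1)]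
    simp only [Nat.add_sub_cancel, show 2 * s + 2 - 1 = 2 * s + 1 by omega]
    have hsq : ∀ j : ℕ, ((-1 : ℝ) ^ j) ^ 2 = 1 := fun j => by
      rw [← pow_mul, mul_comm, pow_mul]; simp
    -- The exponents q = r + 1 and s = 2n - q have the same parity.
    have hsign : (-1 : ℝ) ^ s = (-1) ^ (r + 1) := by
      have h : (-1 : ℝ) ^ s * (-1) ^ (r + 1) = 1 := by
        rw [← pow_add, show s + (r + 1) = 2 * n by omega, pow_mul]; simp
      linear_combination (-1 : ℝ) ^ (r + 1) * h - (-1 : ℝ) ^ s * hsq (r + 1)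
    rw [pow_succ (-1 : ℝ) (s + 1), pow_succ (-1 : ℝ) s, hsign]
    have h := hsq r
    have : ((r : ℝ) + 1) ≠ 0 := by positivity
    push_cast
    have h3 : ((-1 : ℝ) ^ (r + 1)) = -(-1) ^ r := by ring
    have h4 : ((-1 : ℝ) ^ (r + 1 + 1)) = (-1) ^ r := by ring
    rw [h3, h4]
    have h5 : (2 * (r : ℝ) + 1 + 1) = 2 * (r + 1) := by ring
    rw [h5]
    field_simp
    rw [h]
    ring
  · rw [hZ, show 4 * n + 2 - 2 * (2 * n + 1) = 0 by omega,
      show 2 * (2 * n + 1) = 4 * n + 1 + 1 by ring, Nat.factorial_succ (4 * n + 1)]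
    simp only [Nat.add_sub_cancel, bernoulli_zero, Nat.factorial_zero]
    have h1 : (-1 : ℝ) ^ (2 * n + 1 + 1) = 1 := by
      rw [show 2 * n + 1 + 1 = 2 * (n + 1) by ring, pow_mul]; simp
    rw [h1]
    push_cast
    have : (4 * (n : ℝ) + 1 + 1) ≠ 0 := by positivity
    field_simp
    ring

/-! ### The identity and the case n = 1 -/

theorem tsum_identity_real {n : ℕ} (hn : n ≠ 0) :
    ∑' k : ℕ+, 1 / ((k : ℕ) : ℝ) ^ (4 * n + 1)
      + (2 * ∑' k : ℕ+,
          1 / (((k : ℕ) : ℝ) ^ (4 * n + 1) * (Real.exp (2 * Real.pi * ((k : ℕ) : ℝ)) - 1))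
        + Real.pi / (2 * (n : ℝ)) * ∑' k : ℕ+,
          1 / (((k : ℕ) : ℝ) ^ (4 * n) * Real.sinh (Real.pi * ((k : ℕ) : ℝ)) ^ 2)) =
    ((2 : ℝ) ^ (4 * n) / (2 * (n : ℝ)) *
        ∑ q ∈ Finset.Icc 1 (2 * n + 1),
          (-1 : ℝ) ^ (q + 1) * bernoulli (2 * q) * bernoulli (4 * n + 2 - 2 * q) /
            ((Nat.factorial (2 * q - 1) : ℝ) * (Nat.factorial (4 * n + 2 - 2 * q) : ℝ))) *
      Real.pi ^ (4 * n + 1) := by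
  have hn' : (n : ℝ) ≠ 0 := by exact_mod_cast hn
  have hpi := Real.pi_ne_zero
  have hU : Summable (fun k : ℕ+ =>
      1 / (((k : ℕ) : ℝ) ^ (4 * n + 1) * (Real.exp (2 * Real.pi * ((k : ℕ) : ℝ)) - 1))) := by
    simpa only [show 4 * n - 1 + 2 = 4 * n + 1 by omega] using
      summable_one_div_pow_mul_exp_sub_one (4 * n - 1)
  have hV := summable_one_div_pow_mul_sinh_sq (4 * n)
  have hW : Summable (fun k : ℕ+ => 1 / ((k : ℕ) : ℝ) ^ (4 * n + 1)) :=
    summable_pnat_iff_summable_nat (f := fun k : ℕ => 1 / (k : ℝ) ^ (4 * n + 1)) |>.mpr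
      (Real.summable_one_div_nat_pow.mpr (by omega))
  have hker := hasSum_symmetrized_kernel hn _ (fun q hq => hasSum_pnat_one_div_pow_even hq)
  -- `g k` is the sum over m at fixed k; its last term collects the -1/x and -1/x² of the two
  -- expansions.
  have hfib := hker.prod_fiberwise (g := fun k : ℕ+ =>
      Real.pi * (1 / ((k : ℕ) : ℝ) ^ (4 * n + 1)) +
      2 * Real.pi * (1 / (((k : ℕ) : ℝ) ^ (4 * n + 1) *
        (Real.exp (2 * Real.pi * ((k : ℕ) : ℝ)) - 1))) +
      Real.pi ^ 2 / (2 * n) *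
        (1 / (((k : ℕ) : ℝ) ^ (4 * n) * Real.sinh (Real.pi * ((k : ℕ) : ℝ)) ^ 2)) -
      (1 + 1 / (2 * n)) * (1 / (((k : ℕ) : ℝ) ^ 2) ^ (2 * n + 1))) (fun k => by
    have hk : (0 : ℝ) < ((k : ℕ) : ℝ) := by exact_mod_cast k.pos
    have h1 := (hasSum_coth_partialFractions hk).mul_left (1 / ((k : ℕ) : ℝ))
    have h2 := (hasSum_inv_sinh_sq_partialFractions hk).mul_left (1 / (2 * (n : ℝ)))
    have h3 := (h1.add h2).mul_left (1 / (((k : ℕ) : ℝ) ^ 2) ^ (2 * n))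
    have hsinh : Real.sinh (Real.pi * ((k : ℕ) : ℝ)) ≠ 0 :=
      (Real.sinh_pos_iff.mpr (by positivity)).ne'
    have hexp : Real.exp (2 * Real.pi * ((k : ℕ) : ℝ)) - 1 ≠ 0 := by
      have : 0 < 2 * Real.pi * ((k : ℕ) : ℝ) := by positivity
      exact (sub_pos.mpr (Real.one_lt_exp_iff.mpr this)).ne'
    have e : ((k : ℕ) : ℝ) ^ (4 * n) = (((k : ℕ) : ℝ) ^ 2) ^ (2 * n) := by
      rw [← pow_mul]; congr 1; ring
    refine Eq.mpr (congrArg₂ (fun f a => HasSum f a) (funext fun m => ?_) ?_) h3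
    · have hm : (0 : ℝ) < ((m : ℕ) : ℝ) := by exact_mod_cast m.pos
      have : ((k : ℕ) : ℝ) ^ 2 + ((m : ℕ) : ℝ) ^ 2 ≠ 0 := by positivity
      field_simp
    · rw [pow_succ _ (4 * n), pow_succ _ (2 * n), e]
      have hkp : (((k : ℕ) : ℝ) ^ 2) ^ (2 * n) ≠ 0 := by positivity
      generalize (((k : ℕ) : ℝ) ^ 2) ^ (2 * n) = K at hkp
      field_simp
      ring)
  have hdirect := (((hW.hasSum.mul_left Real.pi).add (hU.hasSum.mul_left (2 * Real.pi))).add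
    (hV.hasSum.mul_left (Real.pi ^ 2 / (2 * n)))).sub
    ((hasSum_pnat_one_div_pow_even (q := 2 * n + 1) (by omega)).mul_left (1 + 1 / (2 * (n : ℝ))))
  have huniq := hdirect.unique hfib
  have hbern := alternating_zeta_products_eq_bernoulli_sum hn _ (fun q => rfl)
  rw [← huniq] at hbern
  -- The double sum yields the identity multiplied by π.
  refine mul_left_cancel₀ hpi ?_
  rw [show 4 * n + 2 = 4 * n + 1 + 1 by ring] at hbern ⊢
  rw [pow_succ Real.pi (4 * n + 1)] at hbern
  linear_combination hbern

theorem riemannZeta_natCast_eq_ofReal_tsum_pnat {k : ℕ} (hk : 1 < k) :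
    riemannZeta k = ((∑' m : ℕ+, 1 / ((m : ℕ) : ℝ) ^ k : ℝ) : ℂ) := by
  rw [zeta_nat_eq_tsum_of_gt_one hk,
    tsum_pnat_eq_tsum_of_eq_zero (f := fun m : ℕ => 1 / (m : ℝ) ^ k)
      (by simp [show k ≠ 0 by omega]), Complex.ofReal_tsum]
  push_cast
  rfl

theorem zeta_five_bernoulli_sum :
    (2 : ℝ) ^ (4 * 1) / (2 * ((1 : ℕ) : ℝ)) *
        ∑ q ∈ Finset.Icc 1 (2 * 1 + 1),
          (-1 : ℝ) ^ (q + 1) * bernoulli (2 * q) * bernoulli (4 * 1 + 2 - 2 * q) /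
            ((Nat.factorial (2 * q - 1) : ℝ) * (Nat.factorial (4 * 1 + 2 - 2 * q) : ℝ))
      = 13 / 3780 := by
  have b2 : bernoulli 2 = 1 / 6 := by
    rw [bernoulli_eq_bernoulli'_of_ne_one (by norm_num), bernoulli'_two]
  have b4 : bernoulli 4 = -1 / 30 := by
    rw [bernoulli_eq_bernoulli'_of_ne_one (by norm_num), bernoulli'_four]
  have b5 : bernoulli' 5 = 0 := bernoulli'_eq_zero_of_odd (by decide) (by norm_num)
  have b6 : bernoulli 6 = 1 / 42 := by
    rw [bernoulli_eq_bernoulli'_of_ne_one (by norm_num), bernoulli'_def]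
    norm_num [Finset.sum_range_succ, bernoulli'_two, bernoulli'_three, bernoulli'_four, b5,
      Nat.choose]
  rw [show Finset.Icc 1 (2 * 1 + 1) = {1, 2, 3} by decide]
  norm_num [b2, b4, b6, Nat.factorial]

theorem mainTheorem2 :
    (∀ n : ℕ, 1 ≤ n →
      Summable (fun k : ℕ+ =>
        1 / (((k : ℕ) : ℝ) ^ (4 * n + 1) * (Real.exp (2 * Real.pi * ((k : ℕ) : ℝ)) - 1))) ∧
      Summable (fun k : ℕ+ =>
        1 / (((k : ℕ) : ℝ) ^ (4 * n) * Real.sinh (Real.pi * ((k : ℕ) : ℝ)) ^ 2)) ∧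
      riemannZeta (4 * (n : ℂ) + 1)
        + ((2 * ∑' k : ℕ+,
              1 / (((k : ℕ) : ℝ) ^ (4 * n + 1) * (Real.exp (2 * Real.pi * ((k : ℕ) : ℝ)) - 1))
            + Real.pi / (2 * (n : ℝ)) * ∑' k : ℕ+,
              1 / (((k : ℕ) : ℝ) ^ (4 * n) * Real.sinh (Real.pi * ((k : ℕ) : ℝ)) ^ 2) : ℝ) : ℂ)
        = (((2 : ℚ) ^ (4 * n) / (2 * (n : ℚ)) *
              ∑ q ∈ Finset.Icc 1 (2 * n + 1),
                (-1 : ℚ) ^ (q + 1) * bernoulli (2 * q) * bernoulli (4 * n + 2 - 2 * q) /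
                  ((Nat.factorial (2 * q - 1) : ℚ) *
                    (Nat.factorial (4 * n + 2 - 2 * q) : ℚ)) : ℚ) : ℂ)
          * (Real.pi : ℂ) ^ (4 * n + 1)) ∧
    riemannZeta 5
      + ((2 * ∑' k : ℕ+,
            1 / (((k : ℕ) : ℝ) ^ 5 * (Real.exp (2 * Real.pi * ((k : ℕ) : ℝ)) - 1))
          + Real.pi / 2 * ∑' k : ℕ+,
            1 / (((k : ℕ) : ℝ) ^ 4 * Real.sinh (Real.pi * ((k : ℕ) : ℝ)) ^ 2) : ℝ) : ℂ)
      = 13 / 3780 * (Real.pi : ℂ) ^ 5 := by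
  refine ⟨fun n hn => ⟨?_, summable_one_div_pow_mul_sinh_sq (4 * n), ?_⟩, ?_⟩
  · simpa only [show 4 * n - 1 + 2 = 4 * n + 1 by omega] using
      summable_one_div_pow_mul_exp_sub_one (4 * n - 1)
  · have h := congrArg Complex.ofReal (tsum_identity_real (n := n) (by omega))
    rw [Complex.ofReal_add, ← riemannZeta_natCast_eq_ofReal_tsum_pnat (by omega),
      show ((4 * n + 1 : ℕ) : ℂ) = 4 * (n : ℂ) + 1 by push_cast; rfl] at h
    rw [h]
    push_cast
    rfl
  · have h := tsum_identity_real one_ne_zero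
    rw [zeta_five_bernoulli_sum] at h
    simp only [Nat.cast_one, mul_one, Nat.reduceAdd] at h
    have hc := congrArg Complex.ofReal h
    rw [Complex.ofReal_add, ← riemannZeta_natCast_eq_ofReal_tsum_pnat (by norm_num),
      Nat.cast_ofNat] at hc
    rw [hc]
    push_cast
    rfl
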